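/- All graphs are simple. A strong immersion $\Phi:G\to H$ is an isomorphism of $G$ onto an induced subgraph of $H$; for a subgraph $K\subseteq G$, $\Phi[K]$ denotes the image of $K$. A ray is a one-way infinite path, and a graph is rayless if it contains no ray. A graph has rank $0$ if it is finite; for an ordinal $\alpha>0$ it has rank $\alpha$ if it has no smaller rank and there is a finite set $F$ of vertices such that every connected component of $G-F$ has rank smaller than $\alpha$. For an infinite cardinal $\kappa$, let $\mathbf A_\kappa(\mathcal C^e)$ be the class of connected rayless graphs with at most $\kappa$ vertices that contain no cycle of even length, and for an ordinal $\alpha$ let $\mathbf A_\kappa^\alpha(\mathcal C^e)$ be the class of those members that have rank strictly less than $\alpha$. An open ear of a subgraph $K$ of $G$ is a path in $G$ with at least one edge that meets $K$ exactly in its two end vertices (in particular, it has no edge in common with $K$). For a class $\mathcal C$ of graphs, a strongly universal family is a family $\mathcal F\subseteq\mathcal C$ such that every $G\in\mathcal C$ has a strong immersion into some $H\in\mathcal F$; if $\mathcal C$ admits such a family, its strong complexity $\mathrm{Stc}(\mathcal C)$ is the least cardinality of one. **Theorem.** Let $\kappa$ be an infinite cardinal. For every ordinal $\alpha$ with $0<\alpha<\kappa^+$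 there is a family $\mathcal F\subseteq\mathbf A_\kappa^\alpha(\mathcal C^e)$ such that 1. for every $G\in\mathbf A_\kappa^\alpha(\mathcal C^e)$ and every finite subgraph $K\subseteq G$ there are $H\in\mathcal F$ and a strong immersion $\Phi:G\to H$ such that, if $K$ has no open ear in $G$, then $\Phi[K]$ has no open ear in $H$; 2. $|\mathcal F|\le\kappa$. Moreover, $\mathbf A_\kappa(\mathcal C^e)$ admits a strongly universal family, and $\mathrm{Stc}(\mathbf A_\kappa(\mathcal C^e))=\kappa^+$. -/

import Mathlib

universe u v

open Cardinal

namespace RaylessGraphs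

/-- A graph, bundled with its vertex type, so that one can speak of classes and families of
graphs. -/
structure Grph where
  V : Type u
  graph : SimpleGraph V

/-- A graph is rayless if it contains no one-way infinite path. -/
def IsRayless {V : Type u} (G : SimpleGraph V) : Prop :=
  ¬ ∃ r : ℕ → V, Function.Injective r ∧ ∀ n, G.Adj (r n) (r (n + 1))

/-- `HasRank α G`: the graph `G` has rank `α` in the rayless hierarchy. The graphs of rank `0` are
the finite ones. For `α > 0`, a graph has rank `α` if it has no smaller rank and there is a finite
set `F` of vertices such that every connected component of `G - F` has some rank smaller
than `α`. -/
def HasRank (α : Ordinal.{u}) {V : Type u} (G : SimpleGraph V) : Prop :=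
  (α = 0 ∧ Finite V) ∨
    (α ≠ 0 ∧ (∀ β, β < α → ¬ HasRank β G) ∧
      ∃ F : Set V, F.Finite ∧
        ∀ C : (G.induce Fᶜ).ConnectedComponent, ∃ β, ∃ _ : β < α, HasRank β C.toSimpleGraph)
termination_by α

theorem hasRank_zero_iff {V : Type u} (G : SimpleGraph V) : HasRank 0 G ↔ Finite V := by
  rw [HasRank]
  simp

theorem hasRank_iff_of_ne_zero {α : Ordinal.{u}} (hα : α ≠ 0) {V : Type u} (G : SimpleGraph V) :
    HasRank α G ↔ (∀ β, β < α → ¬ HasRank β G) ∧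
      ∃ F : Set V, F.Finite ∧
        ∀ C : (G.induce Fᶜ).ConnectedComponent, ∃ β, β < α ∧ HasRank β C.toSimpleGraph := by
  conv_lhs => rw [HasRank]
  simp [hα]

/-- A graph is free of a family `𝒦` of graphs if no member of `𝒦` admits an immersion into it, an
immersion being a graph homomorphism that is injective on the vertices. -/
def IsFreeOf (𝒦 : Set Grph.{v}) {V : Type u} (G : SimpleGraph V) : Prop :=
  ∀ K ∈ 𝒦, K.graph.Free G

/-- The family of all even cycles: the cycles on `2 * k` vertices, for `k ≥ 2`. -/
def evenCycles : Set Grph.{0} :=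
  {K | ∃ k : ℕ, 2 ≤ k ∧ K = ⟨Fin (2 * k), SimpleGraph.cycleGraph (2 * k)⟩}

/-- The class of `𝒦`-free `κ`-rayless graphs: connected rayless graphs with at most `κ` vertices
which are free of `𝒦`. -/
def raylessClass (κ : Cardinal.{u}) (𝒦 : Set Grph.{v}) : Set Grph.{u} :=
  {G | G.graph.Connected ∧ #G.V ≤ κ ∧ IsRayless G.graph ∧ IsFreeOf 𝒦 G.graph}

/-- The class of `𝒦`-free `κ`-rayless graphs of rank strictly less than `α`. -/
def raylessClassBelow (κ : Cardinal.{u}) (α : Ordinal.{u}) (𝒦 : Set Grph.{v}) : Set Grph.{u} :=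
  {G | G ∈ raylessClass κ 𝒦 ∧ ∃ β, β < α ∧ HasRank β G.graph}

/-- A walk `p` of `G` is an open ear of the subgraph `K` if it is a path with at least one edge,
its end vertices are exactly those of its vertices that lie in `K`, and none of its edges is an
edge of `K`. -/
def IsOpenEar {V : Type u} {G : SimpleGraph V} (K : G.Subgraph) {a b : V} (p : G.Walk a b) :
    Prop :=
  p.IsPath ∧ 1 ≤ p.length ∧ (∀ w ∈ p.support, w ∈ K.verts ↔ w = a ∨ w = b) ∧
    ∀ e ∈ p.edges, e ∉ K.edgeSet

/-- The subgraph `K` has an open ear in `G`. -/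
def HasOpenEar {V : Type u} {G : SimpleGraph V} (K : G.Subgraph) : Prop :=
  ∃ (a b : V) (p : G.Walk a b), IsOpenEar K p

/-- `F` is a strongly universal family of the class `𝒞`: it is contained in `𝒞`, and every member
of `𝒞` admits a strong immersion into a member of `F`, that is, an isomorphism onto an induced
subgraph. -/
def IsStronglyUniversal (F 𝒞 : Set Grph.{u}) : Prop :=
  F ⊆ 𝒞 ∧ ∀ G ∈ 𝒞, ∃ H ∈ F, Nonempty (G.graph ↪g H.graph)

/-- The strong complexity of a class that admits a strongly universal family: the smallest
cardinality of such a family. -/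
noncomputable def strongComplexity (𝒞 : Set Grph.{u}) : Cardinal.{u + 1} :=
  sInf {c | ∃ F : Set Grph.{u}, IsStronglyUniversal F 𝒞 ∧ #F = c}

end RaylessGraphs

/-! Two of any three numbers have the same parity, so a graph without even cycles contains no theta.
Hence its cycles are path-convex, and in a connected graph every finite vertex set lies in a finite
path-convex set `S` (`OddCycles.exists_pathConvex`). Each component of `G - S` hangs on a single
vertex of `S`, through a finite set of neighbours whose mutual paths inside the component are odd.
Conversely, gluing pieces to a core under this parity condition creates no even cycle
(`oddCycles_glue`).

So a graph of rank at most `α` is coded by a finite core, of which there are countably many, and by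
pieces of smaller rank with finite attaching sets. Given `κ` universal pieces, attaching `κ` copies
of each in all admissible ways to every core serves rank `α` (`exists_isConvexlyUniversal_step`). To
keep the parity condition inside the larger pieces, the induction carries `ConvexlyEmbeds`: a
prescribed finite set lies in a set with path-convex image. This also prevents new open ears.

Since `κ⁺` is regular, all ranks in the class lie below `κ⁺`, so `κ⁺` graphs suffice. Ranks are
unbounded there and monotone under immersions, so fewer do not. -/

namespace RaylessGraphs

/-! ### Paths, ears and cut vertices. -/

section Walks

open SimpleGraph

variable {V : Type u} {W : Type v} {G : SimpleGraph V} {H : SimpleGraph W}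

theorem start_notMem_support_tail {a b : V} {p : G.Walk a b} (hp : p.IsPath) :
    a ∉ p.support.tail := by
  have h := hp.support_nodup
  rw [← p.cons_tail_support] at h
  exact (List.nodup_cons.1 h).1

theorem mem_support_tail_of_ne {a b x : V} {p : G.Walk a b} (hx : x ∈ p.support) (h : x ≠ a) :
    x ∈ p.support.tail :=
  (p.mem_support_iff.1 hx).resolve_left h

theorem isPath_append {a b c : V} {p : G.Walk a b} {q : G.Walk b c} (hp : p.IsPath)
    (hq : q.IsPath) (h : ∀ x ∈ p.support, x ∈ q.support → x = b) : (p.append q).IsPath := by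
  rw [Walk.isPath_def, Walk.support_append, List.nodup_append']
  refine ⟨hp.support_nodup, hq.support_nodup.tail, fun x hx hx' => ?_⟩
  have := h x hx (List.mem_of_mem_tail hx')
  subst this
  exact start_notMem_support_tail hq hx'

theorem isCycle_append_of_internally_disjoint {a b : V} {p : G.Walk a b} {q : G.Walk b a}
    (hp : p.IsPath) (hq : q.IsPath) (h : ∀ x ∈ p.support, x ∈ q.support → x = a ∨ x = b)
    (hn : 1 < p.length ∨ 1 < q.length) : (p.append q).IsCycle := by
  refine hp.isCycle_append hq (fun x hx hx' => ?_) hn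
  rcases h x (List.mem_of_mem_tail hx) (List.mem_of_mem_tail hx') with rfl | rfl
  · exact start_notMem_support_tail hp hx
  · exact start_notMem_support_tail hq hx'

theorem one_lt_length_of_mem_support {a b y : V} {p : G.Walk a b} (hy : y ∈ p.support)
    (ha : y ≠ a) (hb : y ≠ b) : 1 < p.length := by
  cases p with
  | nil => simp_all
  | cons h p => cases p with
    | nil => simp_all
    | cons h p => simp

theorem mem_inter_of_append {a b y x : V} {q : G.Walk a y} {r : G.Walk y b}
    (h : (q.append r).IsPath) (hx : x ∈ q.support) (hx' : x ∈ r.support) : x = y := by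
  by_contra hne
  exact h.ne_of_mem_support_of_append hne hx hx' rfl

theorem exists_append_first_hit {Z : Set V} {y b : V} (p : G.Walk y b) (hb : b ∈ Z) :
    ∃ b' ∈ Z, ∃ (p' : G.Walk y b') (p'' : G.Walk b' b), p = p'.append p'' ∧
      ∀ w ∈ p'.support, w ∈ Z → w = b' := by
  induction p with
  | nil => exact ⟨_, hb, .nil, .nil, rfl, by simp⟩
  | @cons y y' b h p ih =>
    by_cases hy : y ∈ Z
    · exact ⟨y, hy, .nil, .cons h p, rfl, by simp⟩
    · obtain ⟨b', hb', p', p'', rfl, hw⟩ := ih hb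
      refine ⟨b', hb', .cons h p', p'', rfl, fun w hw' hwZ => ?_⟩
      rw [Walk.support_cons, List.mem_cons] at hw'
      rcases hw' with rfl | hw'
      · exact absurd hwZ hy
      · exact hw w hw' hwZ

/-- A path with ends in `Z` that leaves `Z` contains an ear of `Z`. -/
theorem exists_ear {Z : Set V} {a b y : V} {p : G.Walk a b} (hp : p.IsPath) (ha : a ∈ Z)
    (hb : b ∈ Z) (hy : y ∈ p.support) (hyZ : y ∉ Z) :
    ∃ a' ∈ Z, ∃ b' ∈ Z, a' ≠ b' ∧ ∃ r : G.Walk a' b', r.IsPath ∧ y ∈ r.support ∧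
      ∀ w ∈ r.support, w ∈ Z → w = a' ∨ w = b' := by
  obtain ⟨q, r, hq, hr, rfl⟩ := hp.mem_support_iff_exists_append.1 hy
  obtain ⟨a', ha', q', q'', hqe, hq'⟩ := exists_append_first_hit q.reverse ha
  obtain ⟨b', hb', r', r'', rfl, hr'⟩ := exists_append_first_hit r hb
  have hqs : ∀ x ∈ q'.support, x ∈ q.support := fun x hx => by
    rw [← List.mem_reverse, ← Walk.support_reverse, hqe, Walk.mem_support_append_iff]
    exact Or.inl hx
  have hdisj : ∀ x ∈ q'.support, x ∈ r'.support → x = y := fun x hx hx' =>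
    mem_inter_of_append hp (hqs x hx) ((Walk.mem_support_append_iff ..).2 (Or.inl hx'))
  have hq'p : q'.IsPath := by
    have := hq.reverse
    rw [hqe] at this
    exact this.of_append_left
  refine ⟨a', ha', b', hb', ?_, q'.reverse.append r', ?_, ?_, ?_⟩
  · rintro rfl
    exact hyZ (hdisj a' q'.end_mem_support r'.end_mem_support ▸ ha')
  · refine isPath_append hq'p.reverse hr.of_append_left fun x hx hx' => ?_
    rw [Walk.support_reverse, List.mem_reverse] at hx
    exact hdisj x hx hx'
  · simp [Walk.mem_support_append_iff]
  · intro w hw hwZ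
    rw [Walk.mem_support_append_iff, Walk.support_reverse, List.mem_reverse] at hw
    exact hw.imp (fun h => hq' w h hwZ) (fun h => hr' w h hwZ)

/-- The ends are tied to `a` and `b` only by equations so that induction on `p` applies;
`exists_walk_map_eq` is the form used later. -/
theorem exists_map_eq (f : G ↪g H) {x y : W} (p : H.Walk x y)
    (hp : ∀ z ∈ p.support, z ∈ Set.range f) :
    ∀ {a b : V} (ha : f a = x) (hb : f b = y),
      ∃ q : G.Walk a b, (q.map f.toHom) = p.copy ha.symm hb.symm := by
  induction p with
  | nil =>
    intro a b ha hb
    obtain rfl : a = b := f.injective (ha.trans hb.symm)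
    subst ha
    exact ⟨.nil, rfl⟩
  | @cons x x' y h p ih =>
    intro a b ha hb
    obtain ⟨a', rfl⟩ := hp x' (by simp)
    obtain ⟨q, hq⟩ := ih (fun z hz => hp z (by simp [hz])) rfl hb
    subst ha hb
    exact ⟨.cons (f.map_adj_iff.1 h) q, by simpa using hq⟩

theorem exists_walk_map_eq (f : G ↪g H) {a b : V} (p : H.Walk (f a) (f b))
    (hp : ∀ z ∈ p.support, z ∈ Set.range f) :
    ∃ q : G.Walk a b, q.map f.toHom = p := by
  simpa using exists_map_eq f p hp rfl rfl

/-- If every edge leaving `S` ends in `v`, then a walk that leaves `S` passes through `v`. -/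
theorem mem_support_of_leaves {S : Set V} {v : V} (hS : ∀ x ∈ S, ∀ y, G.Adj x y → y ∉ S → y = v)
    {a b : V} (p : G.Walk a b) (ha : a ∈ S) (hb : b ∉ S) : v ∈ p.support := by
  obtain ⟨d, hd, h1, h2⟩ := p.exists_boundary_dart S ha hb
  rw [← hS _ h1 _ d.adj h2]
  exact p.dart_snd_mem_support_of_mem_darts hd

/-- A path visiting `S` from outside would need `v` both to enter and to leave. -/
theorem notMem_support_of_isPath {S : Set V} {v : V}
    (hS : ∀ x ∈ S, ∀ y, G.Adj x y → y ∉ S → y = v) (hv : v ∉ S) {a b x : V} {p : G.Walk a b}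
    (hp : p.IsPath) (ha : a ∉ S) (hb : b ∉ S) (hx : x ∈ S) : x ∉ p.support := by
  intro hxp
  obtain ⟨q, r, hq, hr, rfl⟩ := hp.mem_support_iff_exists_append.1 hxp
  have h1 := mem_support_of_leaves hS q.reverse hx ha
  rw [Walk.support_reverse, List.mem_reverse] at h1
  exact hv (mem_inter_of_append hp h1 (mem_support_of_leaves hS r hx hb) ▸ hx)

theorem support_subset_of_isCycle {S : Set V} {v : V}
    (hS : ∀ x ∈ S, ∀ y, G.Adj x y → y ∉ S → y = v) (hv : v ∉ S) {a : V} {c : G.Walk a a}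
    (hc : c.IsCycle) {x : V} (hx : x ∈ S) (hxc : x ∈ c.support) {y : V} (hy : y ∈ c.support) :
    y ∈ S ∨ y = v := by
  classical
  by_contra! h
  -- Seen from `y`, both arcs of the cycle towards `x` pass through `v`, so `v` would be repeated.
  have hc' := hc.rotate hy
  have hxc' : x ∈ (c.rotate y hy).support := (Walk.mem_support_rotate_iff ..).2 hxc
  obtain ⟨q, r, hqr⟩ := (Walk.mem_support_iff_exists_append).1 hxc'
  rw [hqr] at hc'
  have h1 := mem_support_of_leaves hS q.reverse hx h.1
  rw [Walk.support_reverse, List.mem_reverse] at h1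
  have h2 := mem_support_of_leaves hS r hx h.1
  have h3 := hc'.support_nodup
  rw [Walk.tail_support_append, List.nodup_append'] at h3
  exact h3.2.2 (mem_support_tail_of_ne h1 h.2.symm)
    (mem_support_tail_of_ne h2 (by rintro rfl; exact hv hx))

end Walks

/-! ### Graphs without even cycles. -/

section OddCycles

open SimpleGraph

variable {V : Type u} {W : Type v} {G : SimpleGraph V} {H : SimpleGraph W}

/-- All cycles of `G` have odd length. -/
def OddCycles (G : SimpleGraph V) : Prop :=
  ∀ (a : V) (c : G.Walk a a), c.IsCycle → Odd c.length

theorem isFreeOf_evenCycles_iff : IsFreeOf evenCycles G ↔ OddCycles G := by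
  constructor
  · intro h a c hc
    by_contra hodd
    obtain ⟨k, hk⟩ := Nat.not_odd_iff_even.1 hodd
    have h3 := hc.three_le_length
    refine h ⟨Fin (2 * k), cycleGraph (2 * k)⟩ ⟨k, by omega, rfl⟩ ?_
    exact (cycleGraph_isContained_iff (by omega)).2 ⟨a, c, hc, by omega⟩
  · rintro h K ⟨k, hk, rfl⟩ hcon
    obtain ⟨a, c, hc, hl⟩ := (cycleGraph_isContained_iff (by omega)).1 hcon
    have := h a c hc
    rw [hl] at this
    exact absurd this (by simp)

theorem OddCycles.comap (h : OddCycles H) (f : G →g H) (hf : Function.Injective f) :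
    OddCycles G := fun a c hc => by
  have := h _ (c.map f) ((Walk.isCycle_map_iff_of_injective hf).2 hc)
  rwa [Walk.length_map] at this

/-- The three pairwise sums of lengths would all be odd, yet they add up to an even number. One
path, `r`, may be a single edge: every pair still contains a longer path and so forms a cycle. -/
theorem OddCycles.false_of_theta (h : OddCycles G) {a b : V} {p q r : G.Walk a b}
    (hp : p.IsPath) (hq : q.IsPath) (hr : r.IsPath) (hpl : 1 < p.length) (hql : 1 < q.length)
    (hpq : ∀ x ∈ p.support, x ∈ q.support → x = a ∨ x = b)
    (hpr : ∀ x ∈ p.support, x ∈ r.support → x = a ∨ x = b)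
    (hqr : ∀ x ∈ q.support, x ∈ r.support → x = a ∨ x = b) : False := by
  have key : ∀ {p q : G.Walk a b}, p.IsPath → q.IsPath → 1 < p.length →
      (∀ x ∈ p.support, x ∈ q.support → x = a ∨ x = b) → Odd (p.length + q.length) := by
    intro p q hp hq hl hpq
    have := h _ _ (isCycle_append_of_internally_disjoint hp hq.reverse
      (by simpa using hpq) (Or.inl hl))
    simpa using this
  have h1 := key hp hq hpl hpq
  have h2 := key hp hr hpl hpr
  have h3 := key hq hr hql hqr
  grind

/-- A cycle passing through two distinct vertices splits into two internally disjoint paths. -/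
theorem exists_paths_of_isCycle {v a b : V} {c : G.Walk v v} (hc : c.IsCycle)
    (ha : a ∈ c.support) (hb : b ∈ c.support) (hab : a ≠ b) :
    ∃ p q : G.Walk a b, p.IsPath ∧ q.IsPath ∧ (∀ x ∈ p.support, x ∈ c.support) ∧
      (∀ x ∈ q.support, x ∈ c.support) ∧
      (∀ x ∈ p.support, x ∈ q.support → x = a ∨ x = b) ∧ 3 ≤ p.length + q.length := by
  classical
  have hc' := hc.rotate ha
  have hmem : ∀ x, x ∈ (c.rotate a ha).support ↔ x ∈ c.support := fun x =>
    Walk.mem_support_rotate_iff ..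
  obtain ⟨p, q, hpq⟩ := (Walk.mem_support_iff_exists_append).1 ((hmem b).2 hb)
  have h3 := hc'.three_le_length
  simp only [hpq, Walk.mem_support_append_iff] at hc' hmem
  have hn := hc'.support_nodup
  rw [Walk.tail_support_append, List.nodup_append'] at hn
  refine ⟨p, q.reverse, hc'.isPath_of_append_left (Walk.not_nil_of_ne hab.symm),
    (hc'.isPath_of_append_right (Walk.not_nil_of_ne hab)).reverse,
    fun x hx => (hmem x).1 (Or.inl hx), fun x hx => (hmem x).1 (Or.inr (by simpa using hx)), ?_, ?_⟩
  · intro x hx hx'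
    rw [Walk.support_reverse, List.mem_reverse] at hx'
    by_contra! hne
    exact hn.2.2 (mem_support_tail_of_ne hx hne.1) (mem_support_tail_of_ne hx' hne.2)
  · rw [hpq] at h3
    simpa using h3

end OddCycles

/-! ### Finite path-convex sets. -/

section PathConvex

open SimpleGraph

variable {V : Type u} {W : Type v} {G : SimpleGraph V} {H : SimpleGraph W}

/-- A set of vertices is path-convex if it contains all paths between its vertices. -/
def PathConvex (G : SimpleGraph V) (S : Set V) : Prop :=
  ∀ ⦃a b : V⦄ (p : G.Walk a b), p.IsPath → a ∈ S → b ∈ S → ∀ x ∈ p.support, x ∈ S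

theorem pathConvex_singleton (a : V) : PathConvex G {a} := by
  rintro _ _ p hp rfl rfl x hx
  simpa [(Walk.isPath_iff_nil.1 hp).eq_nil] using hx

/-- Cut a path from `S` to `Z` at its last vertex `t` in `S`. The part before `t` has both ends in
`S`; the part after `t`, prolonged inside `S` from `t` back to `s`, is a path with both ends in `Z`.
-/
theorem PathConvex.union (hG : G.Connected) {S Z : Set V} (hS : PathConvex G S)
    (hZ : PathConvex G Z) {s : V} (hsS : s ∈ S) (hsZ : s ∈ Z) : PathConvex G (S ∪ Z) := by
  classical
  have key : ∀ {a b : V} (p : G.Walk a b), p.IsPath → a ∈ S → b ∈ Z →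
      ∀ x ∈ p.support, x ∈ S ∪ Z := by
    intro a b p hp ha hb x hx
    obtain ⟨t, ht, q, r, hqr, hq⟩ := exists_append_first_hit p.reverse ha
    obtain ⟨w⟩ := hG.preconnected s t
    have hpr := hp.reverse
    rw [hqr] at hpr
    have hx' : x ∈ (q.append r).support := by rw [← hqr]; simpa using hx
    have hw := hS w.bypass w.bypass_isPath hsS ht
    have hpath : (w.bypass.append q.reverse).IsPath :=
      isPath_append w.bypass_isPath hpr.of_append_left.reverse fun y hy hy' =>
        hq y (by simpa using hy') (hw y hy)
    rcases (Walk.mem_support_append_iff ..).1 hx' with h | h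
    · exact Or.inr (hZ _ hpath hsZ hb x ((Walk.mem_support_append_iff ..).2
        (Or.inr (by simpa using h))))
    · exact Or.inl (hS r hpr.of_append_right ht ha x h)
  rintro a b p hp (ha | ha) (hb | hb) x hx
  · exact Or.inl (hS p hp ha hb x hx)
  · exact key p hp ha hb x hx
  · exact key p.reverse hp.reverse hb ha x (by simpa using hx)
  · exact Or.inr (hZ p hp ha hb x hx)

/-- An ear of the cycle would form a theta with its two arcs, at most one of which is a single edge.
-/
theorem OddCycles.pathConvex_of_isCycle (h : OddCycles G) {v : V} {c : G.Walk v v}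
    (hc : c.IsCycle) : PathConvex G {x | x ∈ c.support} := by
  intro a b p hp ha hb y hy
  by_contra hyZ
  obtain ⟨a', ha', b', hb', hne, r, hr, hyr, hrZ⟩ := exists_ear hp ha hb hy hyZ
  obtain ⟨q₁, q₂, hq₁, hq₂, h₁, h₂, h₁₂, hl⟩ := exists_paths_of_isCycle hc ha' hb' hne
  have hrl := one_lt_length_of_mem_support hyr (fun h => hyZ (h ▸ ha')) (fun h => hyZ (h ▸ hb'))
  by_cases h1 : 1 < q₁.length
  · exact h.false_of_theta hr hq₁ hq₂ hrl h1 (fun x hx hx' => hrZ x hx (h₁ x hx'))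
      (fun x hx hx' => hrZ x hx (h₂ x hx')) h₁₂
  · exact h.false_of_theta hr hq₂ hq₁ hrl (by omega) (fun x hx hx' => hrZ x hx (h₂ x hx'))
      (fun x hx hx' => hrZ x hx (h₁ x hx')) fun x hx hx' => h₁₂ x hx' hx

/-- `Z` is a cycle through the edge if there is one; otherwise the edge is a bridge and its two ends
suffice. -/
theorem OddCycles.exists_pathConvex_of_adj (h : OddCycles G) {s x : V} (hsx : G.Adj s x) :
    ∃ Z : Set V, Z.Finite ∧ s ∈ Z ∧ x ∈ Z ∧ PathConvex G Z := by
  by_cases hp : ∃ p : G.Walk x s, p.IsPath ∧ 1 < p.length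
  · obtain ⟨p, hp, hl⟩ := hp
    have hc : (p.append hsx.toWalk).IsCycle :=
      isCycle_append_of_internally_disjoint hp (Walk.IsPath.of_adj hsx)
        (fun y _ hy => by simp at hy; tauto) (Or.inl hl)
    exact ⟨_, List.finite_toSet _, by simp [Walk.mem_support_append_iff], by simp,
      h.pathConvex_of_isCycle hc⟩
  · refine ⟨{s, x}, by simp, by simp, by simp, ?_⟩
    intro a b p hpp ha hb y hy
    by_contra hyZ
    have hl := one_lt_length_of_mem_support hy (by rintro rfl; exact hyZ ha)
      (by rintro rfl; exact hyZ hb)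
    rcases ha with rfl | rfl <;> rcases hb with rfl | rfl
    · simp [(Walk.isPath_iff_nil.1 hpp).eq_nil] at hl
    · exact hp ⟨p.reverse, hpp.reverse, by simpa using hl⟩
    · exact hp ⟨p, hpp, hl⟩
    · simp [(Walk.isPath_iff_nil.1 hpp).eq_nil] at hl

theorem OddCycles.exists_pathConvex_pair (h : OddCycles G) (hG : G.Connected) (a b : V) :
    ∃ Z : Set V, Z.Finite ∧ a ∈ Z ∧ b ∈ Z ∧ PathConvex G Z := by
  obtain ⟨p⟩ := hG.preconnected a b
  induction p with
  | nil => exact ⟨_, Set.finite_singleton _, rfl, rfl, pathConvex_singleton _⟩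
  | cons hadj p ih =>
    obtain ⟨S, hSf, h1, h2, hS⟩ := ih
    obtain ⟨Z, hZf, h3, h4, hZ⟩ := h.exists_pathConvex_of_adj hadj
    exact ⟨Z ∪ S, hZf.union hSf, Or.inl h3, Or.inr h2, hZ.union hG hS h4 h1⟩

/-- In a connected graph without even cycles, every finite set of vertices is contained in a
finite path-convex set. -/
theorem OddCycles.exists_pathConvex (h : OddCycles G) (hG : G.Connected) {F : Set V}
    (hF : F.Finite) : ∃ S : Set V, S.Finite ∧ S.Nonempty ∧ F ⊆ S ∧ PathConvex G S := by
  obtain ⟨r⟩ := hG.nonempty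
  suffices ∃ S : Set V, S.Finite ∧ r ∈ S ∧ F ⊆ S ∧ PathConvex G S by
    obtain ⟨S, h1, h2, h3⟩ := this
    exact ⟨S, h1, ⟨r, h2⟩, h3⟩
  induction F, hF using Set.Finite.induction_on with
  | empty => exact ⟨{r}, by simp, rfl, by simp, pathConvex_singleton r⟩
  | @insert a F ha hF ih =>
    obtain ⟨S, h1, h2, h3, h4⟩ := ih
    obtain ⟨Z, h5, h6, h7, h8⟩ := h.exists_pathConvex_pair hG r a
    exact ⟨S ∪ Z, h1.union h5, Or.inl h2,
      Set.insert_subset (Or.inr h7) (h3.trans Set.subset_union_left), h4.union hG h8 h2 h6⟩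

theorem PathConvex.induce_connected {S : Set V} (hS : PathConvex G S) (hG : G.Connected)
    (hne : S.Nonempty) : (G.induce S).Connected := by
  classical
  obtain ⟨r, hr⟩ := hne
  refine (connected_iff_exists_forall_reachable _).2 ⟨⟨r, hr⟩, fun x => ?_⟩
  obtain ⟨w⟩ := hG.preconnected r x
  exact ⟨w.bypass.induce S (hS _ w.bypass_isPath hr x.2)⟩

end PathConvex

/-! ### Upper bounds on the rank. -/

section Rank

open SimpleGraph

variable {V W : Type u} {G : SimpleGraph V} {H : SimpleGraph W}

/-- `G` has some rank that is at most `β`. -/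
def RankLE (β : Ordinal.{u}) (G : SimpleGraph V) : Prop :=
  ∃ γ ≤ β, HasRank γ G

theorem RankLE.mono {β γ : Ordinal.{u}} (h : RankLE β G) (hβγ : β ≤ γ) : RankLE γ G :=
  let ⟨δ, hδ, h⟩ := h
  ⟨δ, hδ.trans hβγ, h⟩

/-- Bounding the rank removes the minimality clause and the special case of rank `0`: for `β = 0` no
component may remain, so `F` is the whole vertex set. -/
theorem rankLE_iff {β : Ordinal.{u}} :
    RankLE β G ↔ ∃ F : Set V, F.Finite ∧
      ∀ C : (G.induce Fᶜ).ConnectedComponent, ∃ γ < β, RankLE γ C.toSimpleGraph := by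
  constructor
  · rintro ⟨γ, hγ, h⟩
    rcases eq_or_ne γ 0 with rfl | h0
    · have := (hasRank_zero_iff G).1 h
      refine ⟨Set.univ, Set.finite_univ, fun C => ?_⟩
      obtain ⟨⟨x, hx⟩, -⟩ := C.exists_rep
      simp at hx
    · obtain ⟨-, F, hF, hC⟩ := (hasRank_iff_of_ne_zero h0 G).1 h
      refine ⟨F, hF, fun C => ?_⟩
      obtain ⟨δ, hδ, h⟩ := hC C
      exact ⟨δ, hδ.trans_le hγ, δ, le_rfl, h⟩
  · rintro ⟨F, hF, hC⟩
    by_cases hs : ∃ γ < β, HasRank γ G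
    · obtain ⟨γ, hγ, h⟩ := hs
      exact ⟨γ, hγ.le, h⟩
    refine ⟨β, le_rfl, ?_⟩
    rcases eq_or_ne β 0 with rfl | h0
    · rw [hasRank_zero_iff]
      refine Set.finite_univ_iff.1 (hF.subset fun x _ => ?_)
      by_contra hx
      obtain ⟨γ, hγ, -⟩ := hC ((G.induce Fᶜ).connectedComponentMk ⟨x, hx⟩)
      exact not_lt_zero hγ
    · refine (hasRank_iff_of_ne_zero h0 G).2 ⟨fun γ hγ h => hs ⟨γ, hγ, h⟩, F, hF, fun C => ?_⟩
      obtain ⟨γ, hγ, δ, hδ, h⟩ := hC C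
      exact ⟨δ, hδ.trans_lt hγ, h⟩

theorem exists_hom_of_range_subset {A : Type*} {B : Type*} {K : Type*} {G : SimpleGraph A}
    {L : SimpleGraph B} {H : SimpleGraph K} (f : G ↪g H) (g : L →g H)
    (hg : Function.Injective g) (h : ∀ x, g x ∈ Set.range f) :
    ∃ k : L →g G, Function.Injective k := by
  choose k hk using h
  refine ⟨⟨k, fun {x y} hxy => ?_⟩, fun x y hxy => hg ?_⟩
  · rw [← f.map_adj_iff, hk, hk]
    exact g.map_adj hxy
  · rw [← hk x, ← hk y]
    exact congrArg f hxy

theorem exists_component_hom {A : Type*} {B : Type*} {G : SimpleGraph A} {H : SimpleGraph B}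
    (f : G →g H) (hf : Function.Injective f) (C : G.ConnectedComponent) :
    ∃ k : C.toSimpleGraph →g (C.map f).toSimpleGraph, Function.Injective k :=
  ⟨⟨fun x => ⟨f x.1, congrArg (ConnectedComponent.map f) x.2⟩,
    fun {x y} h => f.map_adj (v := x.1) (w := y.1) h⟩,
    fun _ _ hxy => Subtype.ext (hf (congrArg Subtype.val hxy))⟩

/-- The preimage of a separator is finite, and each component left over maps into a component of `H
- F`. -/
theorem RankLE.comap {β : Ordinal.{u}} (h : RankLE β H) (f : G →g H)
    (hf : Function.Injective f) : RankLE β G := by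
  induction β using WellFoundedLT.induction generalizing V W with
  | ind β ih =>
    obtain ⟨F, hF, hC⟩ := rankLE_iff.1 h
    refine rankLE_iff.2 ⟨f ⁻¹' F, hF.preimage hf.injOn, fun C => ?_⟩
    let f' : G.induce (f ⁻¹' F)ᶜ →g H.induce Fᶜ := ⟨fun x => ⟨f x, x.2⟩, fun h => f.map_adj h⟩
    obtain ⟨γ, hγ, hr⟩ := hC (C.map f')
    obtain ⟨k, hk⟩ := exists_component_hom f'
      (fun x y hxy => Subtype.ext (hf (congrArg Subtype.val hxy))) C
    exact ⟨γ, hγ, ih γ hγ hr k hk⟩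

end Rank

/-! ### Gluing pieces to single vertices of a core. -/

section Glue

open SimpleGraph

variable {V₀ : Type} {J : Type u} (G₀ : SimpleGraph V₀) (P : J → Grph.{u}) (b : J → V₀)
  (N : ∀ j, Set (P j).V)

/-- The adjacency relation of `glue`. -/
inductive GlueAdj : V₀ ⊕ (Σ j, (P j).V) → V₀ ⊕ (Σ j, (P j).V) → Prop
  | core {x y : V₀} : G₀.Adj x y → GlueAdj (.inl x) (.inl y)
  | piece {j : J} {x y : (P j).V} : (P j).graph.Adj x y → GlueAdj (.inr ⟨j, x⟩) (.inr ⟨j, y⟩)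
  | up {j : J} {x : (P j).V} : x ∈ N j → GlueAdj (.inl (b j)) (.inr ⟨j, x⟩)
  | down {j : J} {x : (P j).V} : x ∈ N j → GlueAdj (.inr ⟨j, x⟩) (.inl (b j))

/-- The graph obtained from the core `G₀` and the disjoint pieces `P j` by joining the vertex `b j`
of the core to the vertices in the set `N j` of the piece `P j`, for every `j`. -/
def glue : SimpleGraph (V₀ ⊕ (Σ j, (P j).V)) where
  Adj := GlueAdj G₀ P b N
  symm := ⟨fun x y h => by
    cases h with
    | core h => exact .core h.symm
    | piece h => exact .piece h.symm
    | up h => exact .down h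
    | down h => exact .up h⟩
  loopless := ⟨fun x h => by
    cases h with
    | core h => exact h.ne rfl
    | piece h => exact h.ne rfl⟩

/-- The core of a glued graph. -/
def glueCore : G₀ ↪g glue G₀ P b N where
  toFun := .inl
  inj' := Sum.inl_injective
  map_rel_iff' := ⟨fun h => by cases h; assumption, .core⟩

/-- The pieces of a glued graph. -/
def gluePiece (j : J) : (P j).graph ↪g glue G₀ P b N where
  toFun x := .inr ⟨j, x⟩
  inj' x y h := by simpa using h
  map_rel_iff' := ⟨fun h => by cases h; assumption, .piece⟩

variable {G₀ P b N}

theorem glue_leaves (j : J) : ∀ x ∈ Set.range (gluePiece G₀ P b N j), ∀ y,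
    (glue G₀ P b N).Adj x y → y ∉ Set.range (gluePiece G₀ P b N j) → y = .inl (b j) := by
  rintro _ ⟨x, rfl⟩ y h hy
  cases h with
  | piece h => exact absurd ⟨_, rfl⟩ hy
  | down h => rfl

theorem glue_adj_inr_inl {z : Σ j, (P j).V} {v : V₀} :
    (glue G₀ P b N).Adj (.inr z) (.inl v) ↔ b z.1 = v ∧ z.2 ∈ N z.1 := by
  constructor
  · intro h
    cases h
    exact ⟨rfl, by assumption⟩
  · rintro ⟨rfl, h⟩
    exact .down h

theorem fst_eq_of_glue_adj {z w : Σ j, (P j).V} (h : (glue G₀ P b N).Adj (.inr z) (.inr w)) :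
    z.1 = w.1 := by
  cases h
  rfl

theorem inl_notMem_range_gluePiece (j : J) (x : V₀) :
    .inl x ∉ Set.range (gluePiece G₀ P b N j) := by
  rintro ⟨y, hy⟩
  cases hy

theorem pathConvex_range_glueCore : PathConvex (glue G₀ P b N) (Set.range .inl) := by
  rintro _ _ p hp ⟨a, rfl⟩ ⟨a', rfl⟩ x hx
  rcases x with x | ⟨j, x⟩
  · exact ⟨x, rfl⟩
  · exact absurd hx (notMem_support_of_isPath (glue_leaves j) (inl_notMem_range_gluePiece j _) hp
      (inl_notMem_range_gluePiece j _) (inl_notMem_range_gluePiece j _) ⟨x, rfl⟩)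

/-- All paths between distinct vertices of `N` have odd length. -/
def OddPaths {V : Type u} (G : SimpleGraph V) (N : Set V) : Prop :=
  ∀ ⦃x y : V⦄, x ∈ N → y ∈ N → x ≠ y → ∀ p : G.Walk x y, p.IsPath → Odd p.length

theorem OddCycles.odd_length_of_support_subset {V : Type u} {W : Type v} {G : SimpleGraph V}
    {H : SimpleGraph W} (h : OddCycles G) (f : G ↪g H) {a : W} {c : H.Walk a a} (hc : c.IsCycle)
    (hs : ∀ x ∈ c.support, x ∈ Set.range f) : Odd c.length := by
  obtain ⟨a, rfl⟩ := hs a c.start_mem_support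
  obtain ⟨q, rfl⟩ := exists_walk_map_eq f c hs
  rw [Walk.length_map]
  exact h _ _ ((Walk.isCycle_map_iff_of_injective f.injective).1 hc)

/-- A cycle leaving the core lives in one piece `P j` together with `b j`. If it uses `b j`, the
rest is a path between two vertices of `N j`, of odd length, and two more edges keep the parity. -/
theorem oddCycles_glue (h₀ : OddCycles G₀) (hP : ∀ j, OddCycles (P j).graph)
    (hN : ∀ j, OddPaths (P j).graph (N j)) : OddCycles (glue G₀ P b N) := by
  classical
  intro a c hc
  by_cases hcore : ∀ x ∈ c.support, x ∈ Set.range (glueCore G₀ P b N)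
  · exact h₀.odd_length_of_support_subset _ hc hcore
  push Not at hcore
  obtain ⟨x | ⟨j, x⟩, hxc, hx⟩ := hcore
  · exact absurd ⟨x, rfl⟩ hx
  have hsub := fun y hy => support_subset_of_isCycle (glue_leaves j)
    (inl_notMem_range_gluePiece j _) hc (x := .inr ⟨j, x⟩) ⟨x, rfl⟩ hxc (y := y) hy
  by_cases hv : .inl (b j) ∈ c.support
  · have hc' := hc.rotate hv
    rw [← Walk.length_rotate c _ hv]
    have hsub' : ∀ y ∈ (c.rotate _ hv).support,
        y ∈ Set.range (gluePiece G₀ P b N j) ∨ y = .inl (b j) := fun y hy =>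
      hsub y ((Walk.mem_support_rotate_iff ..).1 hy)
    generalize c.rotate _ hv = d at hc' hsub'
    cases d with
    | nil => exact absurd hc' Walk.not_isCycle_nil
    | @cons _ w _ h p =>
      obtain ⟨hp, he⟩ := (Walk.cons_isCycle_iff _ _).1 hc'
      obtain ⟨y, rfl⟩ : w ∈ Set.range (gluePiece G₀ P b N j) :=
        (hsub' w (by simp)).resolve_right h.ne'
      obtain ⟨w', q, h', rfl⟩ : ∃ (w' : _) (q : (glue G₀ P b N).Walk _ w')
          (h' : (glue G₀ P b N).Adj w' (.inl (b j))), p = q.concat h' := by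
        cases p with
        | cons h p =>
          obtain ⟨w', q, h', hq⟩ := Walk.exists_cons_eq_concat h p
          exact ⟨w', q, h', hq⟩
      obtain ⟨hq, hbq⟩ := (Walk.concat_isPath_iff h').1 hp
      have hqs : ∀ z ∈ q.support, z ∈ Set.range (gluePiece G₀ P b N j) := fun z hz =>
        (hsub' z (by simp [Walk.support_concat, hz])).resolve_right
          (by rintro rfl; exact hbq hz)
      obtain ⟨y', rfl⟩ := hqs w' q.end_mem_support
      obtain ⟨r, rfl⟩ := exists_walk_map_eq _ q hqs
      have hy : y ∈ N j := (glue_adj_inr_inl.1 h.symm).2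
      have hy' : y' ∈ N j := (glue_adj_inr_inl.1 h').2
      -- Otherwise the cycle would use the edge from `b j` to `y` twice.
      have hne : y ≠ y' := by
        rintro rfl
        refine he ?_
        simp [Walk.edges_concat, Sym2.eq_swap]
      have := hN j hy hy' hne r
        ((Walk.isPath_map_iff_of_injective (gluePiece G₀ P b N j).injective).1 hq)
      simp only [Walk.length_cons, Walk.length_concat, Walk.length_map]
      grind
  · exact (hP j).odd_length_of_support_subset (gluePiece G₀ P b N j) hc fun y hy =>
      (hsub y hy).resolve_right (by rintro rfl; exact hv hy)

/-- A ray leaves the finite core for good, and different pieces are not adjacent, so a tail stays in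
one piece. -/
theorem isRayless_glue [Finite V₀] (hP : ∀ j, IsRayless (P j).graph) :
    IsRayless (glue G₀ P b N) := by
  rintro ⟨r, hr, hadj⟩
  have hfin : {n | r n ∈ Set.range (Sum.inl : V₀ → V₀ ⊕ (Σ j, (P j).V))}.Finite :=
    (Set.finite_range _).preimage hr.injOn
  obtain ⟨m, hm⟩ := hfin.bddAbove
  have hout : ∀ n, ∃ y, r (m + 1 + n) = .inr y := by
    intro n
    rcases h : r (m + 1 + n) with x | y
    · have : m + 1 + n ≤ m := hm ⟨x, h.symm⟩
      omega
    · exact ⟨y, rfl⟩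
  choose y hy using hout
  have hstep : ∀ n, ∃ z : (P (y 0).1).V, r (m + 1 + n) = .inr ⟨(y 0).1, z⟩ := by
    intro n
    induction n with
    | zero => exact ⟨(y 0).2, hy 0⟩
    | succ n ih =>
      obtain ⟨z, hz⟩ := ih
      have h := hadj (m + 1 + n)
      rw [hz, add_assoc (m + 1) n 1, hy (n + 1)] at h
      rw [hy (n + 1)]
      generalize y (n + 1) = w at h
      cases h
      exact ⟨_, rfl⟩
  choose z hz using hstep
  refine hP (y 0).1 ⟨z, fun n k h => ?_, fun n => ?_⟩
  · have : r (m + 1 + n) = r (m + 1 + k) := by rw [hz, hz, h]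
    have := hr this
    omega
  · have h := hadj (m + 1 + n)
    rw [add_assoc (m + 1) n 1, hz, hz] at h
    exact (gluePiece G₀ P b N _).map_adj_iff.1 h

theorem connected_glue (h₀ : G₀.Connected) (hP : ∀ j, (P j).graph.Connected)
    (hN : ∀ j, (N j).Nonempty) : (glue G₀ P b N).Connected := by
  obtain ⟨r⟩ := h₀.nonempty
  have hcore : ∀ x, (glue G₀ P b N).Reachable (.inl r) (.inl x) := fun x =>
    (h₀.preconnected r x).map (glueCore G₀ P b N).toHom
  refine (connected_iff_exists_forall_reachable _).2 ⟨.inl r, ?_⟩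
  rintro (x | ⟨j, x⟩)
  · exact hcore x
  · obtain ⟨y, hy⟩ := hN j
    refine (hcore (b j)).trans (Reachable.trans (v := .inr ⟨j, y⟩) ?_ ?_)
    · exact Adj.reachable (.up hy)
    · exact ((hP j).preconnected y x).map (gluePiece G₀ P b N j).toHom

/-- The core is the separator: each component of the rest lies inside one piece. -/
theorem rankLE_glue [Finite V₀] {β : Ordinal.{u}} (hP : ∀ j, ∃ γ < β, RankLE γ (P j).graph) :
    RankLE β (glue G₀ P b N) := by
  refine rankLE_iff.2 ⟨Set.range .inl, Set.finite_range _, fun C => ?_⟩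
  obtain ⟨⟨x | ⟨j, x⟩, hx⟩, rfl⟩ := C.exists_rep
  · exact absurd ⟨x, rfl⟩ hx
  obtain ⟨γ, hγ, h⟩ := hP j
  obtain ⟨k, hk⟩ := exists_hom_of_range_subset (gluePiece G₀ P b N j)
    ((Embedding.induce _).toHom.comp (ConnectedComponent.toSimpleGraph_hom
      (((glue G₀ P b N).induce (Set.range Sum.inl)ᶜ).connectedComponentMk ⟨.inr ⟨j, x⟩, hx⟩)))
    (fun x y hxy => Subtype.ext (Subtype.ext hxy)) (by
      rintro ⟨y, hy⟩
      by_contra hcon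
      obtain ⟨p⟩ := ConnectedComponent.exact ((ConnectedComponent.mem_supp_iff _ _).1 hy)
      have := mem_support_of_leaves (glue_leaves j) (p.map (Embedding.induce _).toHom).reverse
        ⟨x, rfl⟩ hcon
      rw [Walk.support_reverse, List.mem_reverse, Walk.support_map, List.mem_map] at this
      obtain ⟨z, -, hz⟩ := this
      exact z.2 ⟨b j, hz.symm⟩)
  exact ⟨γ, hγ, h.comap k hk⟩

theorem mk_sigma_le_of_le {ι : Type u} {κ : Cardinal.{u}} (hκ : ℵ₀ ≤ κ) (hι : #ι ≤ κ)
    {f : ι → Type u} (hf : ∀ i, #(f i) ≤ κ) : #(Σ i, f i) ≤ κ := by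
  rw [mk_sigma]
  exact (sum_le_mk_mul_iSup _).trans (mul_le_of_le hκ hι (ciSup_le' hf))

theorem mk_glue_le [Finite V₀] {κ : Cardinal.{u}} (hκ : ℵ₀ ≤ κ) (hJ : #J ≤ κ)
    (hP : ∀ j, #(P j).V ≤ κ) : #(V₀ ⊕ (Σ j, (P j).V)) ≤ κ := by
  rw [mk_sum]
  refine add_le_of_le hκ ?_ ?_
  · exact ((lift_lt_aleph0.2 (lt_aleph0_of_finite V₀)).le).trans hκ
  · rw [Cardinal.lift_id']
    exact mk_sigma_le_of_le hκ hJ hP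

theorem glue_mem_raylessClass [Finite V₀] {κ : Cardinal.{u}} (hκ : ℵ₀ ≤ κ) (hJ : #J ≤ κ)
    (h₀ : G₀.Connected) (h₀' : OddCycles G₀) (hP : ∀ j, P j ∈ raylessClass κ evenCycles)
    (hN : ∀ j, (N j).Nonempty) (hN' : ∀ j, OddPaths (P j).graph (N j)) :
    (⟨_, glue G₀ P b N⟩ : Grph.{u}) ∈ raylessClass κ evenCycles :=
  ⟨connected_glue h₀ (fun j => (hP j).1) hN, mk_glue_le hκ hJ fun j => (hP j).2.1,
    isRayless_glue fun j => (hP j).2.2.1, isFreeOf_evenCycles_iff.2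
      (oddCycles_glue h₀' (fun j => isFreeOf_evenCycles_iff.1 (hP j).2.2.2) hN')⟩

end Glue

/-! ### How components attach to a path-convex set. -/

section Attachment

open SimpleGraph

variable {V : Type u} {G : SimpleGraph V} {A S : Set V}

/-- Two vertices in the same component of `G - S` are joined by a path avoiding `S`. -/
theorem exists_path_of_mem_component (hA : ∀ x, x ∈ A ↔ x ∉ S)
    {C : (G.induce A).ConnectedComponent} {x y : A}
    (hx : x ∈ C) (hy : y ∈ C) :
    ∃ p : G.Walk x y, p.IsPath ∧ ∀ z ∈ p.support, z ∉ S := by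
  classical
  obtain ⟨p⟩ := ConnectedComponent.exact
    (((ConnectedComponent.mem_supp_iff _ _).1 hx).trans
      ((ConnectedComponent.mem_supp_iff _ _).1 hy).symm)
  refine ⟨p.bypass.map (Embedding.induce A).toHom,
    (Walk.isPath_map_iff_of_injective Subtype.val_injective).2 p.bypass_isPath, ?_⟩
  intro z hz
  have hz' : z ∈ p.bypass.support.map (Embedding.induce A).toHom :=
    Walk.support_map (Embedding.induce A).toHom p.bypass ▸ hz
  obtain ⟨w, -, rfl⟩ := List.mem_map.1 hz'
  exact (hA _).1 w.2

/-- A component of the complement of a path-convex set is attached to a single vertex. -/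
theorem PathConvex.exists_attachment (hA : ∀ x, x ∈ A ↔ x ∉ S) (hS : PathConvex G S)
    (hne : S.Nonempty) (hG : G.Connected)
    (C : (G.induce A).ConnectedComponent) :
    ∃ v ∈ S, (∃ x : A, x ∈ C ∧ G.Adj v x) ∧ ∀ x : A, x ∈ C → ∀ w ∈ S, G.Adj w x → w = v := by
  obtain ⟨r, hr⟩ := hne
  obtain ⟨c, hc⟩ := C.exists_rep
  obtain ⟨p⟩ := hG.preconnected c r
  obtain ⟨d, -, ⟨hd, hdC⟩, hd'⟩ := p.exists_boundary_dart
    {x | ∃ h : x ∈ A, (⟨x, h⟩ : A) ∈ C} ⟨c.2, hc⟩ (fun ⟨h, _⟩ => (hA _).1 h hr)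
  have hdS : d.snd ∈ S := by
    by_contra h
    refine hd' ⟨(hA _).2 h, ?_⟩
    rw [← (ConnectedComponent.mem_supp_iff _ _).1 hdC]
    exact ConnectedComponent.sound (Adj.reachable (G := G.induce A) d.adj.symm)
  refine ⟨d.snd, hdS, ⟨⟨d.fst, hd⟩, hdC, d.adj.symm⟩, fun x hx w hw hwx => ?_⟩
  by_contra hne
  obtain ⟨q, hq, hqS⟩ := exists_path_of_mem_component hA hx hdC
  -- A second attachment vertex `w` would give a path with both ends in `S` running through the
  -- component.
  have hpath : (Walk.cons hwx (q.concat d.adj)).IsPath := by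
    rw [Walk.cons_isPath_iff, Walk.concat_isPath_iff]
    refine ⟨⟨hq, fun h => hqS _ h hdS⟩, ?_⟩
    rw [Walk.support_concat, List.mem_append, List.mem_singleton]
    exact fun h => h.elim (fun h => hqS _ h hw) hne
  exact (hA _).1 x.2 (hS _ hpath hw hdS x (by simp [Walk.support_concat]))

/-- Fix one neighbour `x` and a finite path-convex `Z` containing `v` and `x`. Any other neighbour
`y` lies on a path from `x` through the component to `v`, hence in `Z`. -/
theorem OddCycles.finite_attachment (hA : ∀ x, x ∈ A ↔ x ∉ S) (h : OddCycles G)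
    (C : (G.induce A).ConnectedComponent) {v : V} (hv : v ∈ S) : {x : C | G.Adj v x.1}.Finite := by
  by_cases hne : {x : C | G.Adj v x.1}.Nonempty
  · obtain ⟨x, hx⟩ := hne
    obtain ⟨Z, hZf, hvZ, hxZ, hZ⟩ := h.exists_pathConvex_of_adj hx
    refine (hZf.preimage (f := fun x : C => (x.1 : V))
      (fun x _ y _ h => Subtype.ext (Subtype.ext h))).subset fun y hy => ?_
    obtain ⟨q, hq, hqS⟩ := exists_path_of_mem_component hA x.2 y.2
    exact hZ (q.concat (Adj.symm hy)) (hq.concat (fun h => hqS _ h hv) _) hxZ hvZ y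
      (by simp [Walk.support_concat])
  · rw [Set.not_nonempty_iff_eq_empty.1 hne]
    exact Set.finite_empty

/-- Two edges at `v` close such a path to a cycle. -/
theorem OddCycles.oddPaths_attachment (hA : ∀ x, x ∈ A ↔ x ∉ S) (h : OddCycles G)
    (C : (G.induce A).ConnectedComponent) {v : V} (hv : v ∈ S) :
    OddPaths C.toSimpleGraph {x : C | G.Adj v x.1} := by
  intro x y hx hy hne p hp
  let f : C.toSimpleGraph →g G := (Embedding.induce A).toHom.comp C.toSimpleGraph_hom
  have hf : Function.Injective f := fun x y h => Subtype.ext (Subtype.ext h)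
  have hvp : v ∉ (p.map f).support := by
    rw [Walk.support_map, List.mem_map]
    rintro ⟨z, -, rfl⟩
    exact (hA _).1 z.1.2 hv
  have hvx : G.Adj v (f x) := hx
  have hyv : G.Adj (f y) v := Adj.symm hy
  have hpath := (Walk.isPath_map_iff_of_injective hf).2 hp
  have hcyc : ((p.map f).append (.cons hyv (.cons hvx .nil))).IsCycle := by
    refine isCycle_append_of_internally_disjoint hpath ?_ ?_ (Or.inr (by simp))
    · have : f y ≠ f x := fun h => hne (hf h).symm
      simp [Walk.cons_isPath_iff, hvx.ne, hyv.ne, this]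
    · intro z hz hz'
      simp only [Walk.support_cons, Walk.support_nil, List.mem_cons, List.not_mem_nil,
        or_false] at hz'
      rcases hz' with rfl | rfl | rfl
      · exact Or.inr rfl
      · exact absurd hz hvp
      · exact Or.inl rfl
  have := h _ _ hcyc
  simp only [Walk.length_append, Walk.length_map, Walk.length_cons, Walk.length_nil] at this
  grind

end Attachment

/-! ### The universal gluing over a finite core. -/

section Universal

open SimpleGraph

/-- `G` has a strong immersion into `H` that maps some set containing `S₀` onto a path-convex
set. -/
def ConvexlyEmbeds {V W : Type u} (G : SimpleGraph V) (S₀ : Set V) (H : SimpleGraph W) : Prop :=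
  ∃ (Φ : G ↪g H) (T : Set V), S₀ ⊆ T ∧ PathConvex H (Φ '' T)

/-- The host `H` might have new paths between vertices of the image of `N`; path-convexity forces
them all to come from `G`. -/
theorem OddPaths.image {V : Type u} {W : Type v} {G : SimpleGraph V} {H : SimpleGraph W}
    {N T : Set V} (h : OddPaths G N) (Φ : G ↪g H) (hNT : N ⊆ T) (hT : PathConvex H (Φ '' T)) :
    OddPaths H (Φ '' N) := by
  rintro _ _ ⟨x, hx, rfl⟩ ⟨y, hy, rfl⟩ hne p hp
  obtain ⟨q, rfl⟩ := exists_walk_map_eq Φ p fun z hz =>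
    Set.image_subset_range _ _ (hT p hp ⟨x, hNT hx, rfl⟩ ⟨y, hNT hy, rfl⟩ z hz)
  rw [Walk.length_map]
  exact h hx hy (fun h => hne (congrArg Φ h)) q
    ((Walk.isPath_map_iff_of_injective Φ.injective).1 hp)

variable {ι : Type u} (κ : Cardinal.{u}) (V₀ : Type) (P : ι → Grph.{u})

/-- The pieces of `universalGlue`: `κ` copies of every graph of the family, for every vertex of the
core and every admissible way to attach the graph to that vertex. -/
abbrev PieceIndex : Type u :=
  {j : V₀ × κ.out × (Σ i, Finset (P i).V) //
    j.2.2.2.Nonempty ∧ OddPaths (P j.2.2.1).graph j.2.2.2}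

variable {V₀}

/-- The graph with the given core to which `κ` copies of all members of the family are attached in
all admissible ways. -/
def universalGlue (G₀ : SimpleGraph V₀) : Grph.{u} :=
  ⟨_, glue G₀ (fun j : PieceIndex κ V₀ P => P j.1.2.2.1) (fun j => j.1.1) (fun j => j.1.2.2.2)⟩

variable {κ P}

theorem mk_finset_le {α : Type u} {κ : Cardinal.{u}} (hκ : ℵ₀ ≤ κ) (hα : #α ≤ κ) :
    #(Finset α) ≤ κ := by
  cases finite_or_infinite α
  · exact (lt_aleph0_of_finite _).le.trans hκ
  · rwa [mk_finset_of_infinite]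

theorem mk_pieceIndex_le [Finite V₀] (hκ : ℵ₀ ≤ κ) (hι : #ι ≤ κ) (hP : ∀ i, #(P i).V ≤ κ) :
    #(PieceIndex κ V₀ P) ≤ κ := by
  refine (mk_subtype_le _).trans ?_
  rw [mk_prod, mk_prod]
  simp only [lift_id, Cardinal.lift_id', mk_out]
  refine mul_le_of_le hκ ?_ (mul_le_of_le hκ le_rfl ?_)
  · exact ((lift_lt_aleph0.2 (lt_aleph0_of_finite V₀)).le).trans hκ
  · exact mk_sigma_le_of_le hκ hι fun i => mk_finset_le hκ (hP i)

theorem universalGlue_mem_raylessClass [Finite V₀] (hκ : ℵ₀ ≤ κ) (hι : #ι ≤ κ)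
    (hP : ∀ i, P i ∈ raylessClass κ evenCycles) {G₀ : SimpleGraph V₀} (h₀ : G₀.Connected)
    (h₀' : OddCycles G₀) : universalGlue κ P G₀ ∈ raylessClass κ evenCycles :=
  glue_mem_raylessClass hκ (mk_pieceIndex_le hκ hι fun i => (hP i).2.1) h₀ h₀' (fun _ => hP _)
    (fun j => j.2.1) (fun j => j.2.2)

/-- `S` goes onto the core, and each component `C` into the copy indexed by its attachment vertex,
its piece and the image of its attaching set. That index is admissible by `OddPaths.image`. -/
theorem exists_embedding_universalGlue {V : Type u} {G : SimpleGraph V} (hG : G.Connected)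
    (hodd : OddCycles G) (hV : #V ≤ κ) {A S : Set V}
    (hA : ∀ x, x ∈ A ↔ x ∉ S) (hne : S.Nonempty) (hS : PathConvex G S)
    {G₀ : SimpleGraph V₀} (e : G.induce S ≃g G₀)
    (hU : ∀ (C : (G.induce A).ConnectedComponent) (N : Set C), N.Finite →
      ∃ i, ConvexlyEmbeds C.toSimpleGraph N (P i).graph) :
    ∃ Φ : G ↪g (universalGlue κ P G₀).graph, Φ '' S = Set.range .inl := by
  classical
  choose v hvS hv hvu using hS.exists_attachment hA hne hG
  choose i φ T hT hφ using fun C => hU C {x : C | G.Adj (v C) x.1}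
    (hodd.finite_attachment hA C (hvS C))
  -- There are at most `κ` components, so each gets a private copy number, which makes `j`
  -- injective.
  obtain ⟨code⟩ : Nonempty ((G.induce A).ConnectedComponent ↪ κ.out) := by
    rw [← Cardinal.le_def, mk_out]
    exact ((mk_le_of_surjective (f := (G.induce A).connectedComponentMk)
      fun C => C.exists_rep).trans (mk_set_le _)).trans hV
  let j : (G.induce A).ConnectedComponent → PieceIndex κ V₀ P := fun C =>
    ⟨(e ⟨v C, hvS C⟩, code C,
      ⟨i C, ((hodd.finite_attachment hA C (hvS C)).image (φ C)).toFinset⟩), by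
      obtain ⟨x, hxC, hx⟩ := hv C
      exact (Set.Finite.toFinset_nonempty _).2 ⟨_, ⟨x, hxC⟩, hx, rfl⟩, by
      rw [Set.Finite.coe_toFinset]
      exact (hodd.oddPaths_attachment hA C (hvS C)).image (φ C) (hT C) (hφ C)⟩
  have hj : Function.Injective j := fun C D h => code.injective (congrArg (fun j => j.1.2.1) h)
  let Φ : V → (universalGlue κ P G₀).V := fun x =>
    if h : x ∈ S then .inl (e ⟨x, h⟩) else
      .inr ⟨j ((G.induce A).connectedComponentMk ⟨x, (hA x).2 h⟩),
        φ _ ⟨⟨x, (hA x).2 h⟩, rfl⟩⟩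
  have hΦS : ∀ x (h : x ∈ S), Φ x = .inl (e ⟨x, h⟩) := fun x h => dif_pos h
  have hΦC : ∀ C x (h : x ∉ S) (hx : (⟨x, (hA x).2 h⟩ : A) ∈ C),
      Φ x = .inr ⟨j C, φ C ⟨⟨x, (hA x).2 h⟩, hx⟩⟩ := by
    rintro C x h rfl
    exact dif_neg h
  have hmix : ∀ x y, x ∉ S → y ∈ S →
      ((universalGlue κ P G₀).graph.Adj (Φ x) (Φ y) ↔ G.Adj x y) := by
    intro x y hx hy
    rw [hΦC _ x hx rfl, hΦS y hy]
    refine glue_adj_inr_inl.trans ⟨?_, fun hxy => ?_⟩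
    · rintro ⟨h1, h2⟩
      have h1 : v _ = y := congrArg Subtype.val (e.injective h1)
      obtain ⟨z, hz, hzx⟩ := (Set.Finite.mem_toFinset _).1 h2
      rw [(φ _).injective hzx, Set.mem_ofPred, h1] at hz
      exact hz.symm
    · have hyv := hvu _ ⟨x, (hA x).2 hx⟩ rfl y hy hxy.symm
      refine ⟨congrArg e (Subtype.ext hyv.symm), (Set.Finite.mem_toFinset _).2 ⟨_, ?_, rfl⟩⟩
      exact hyv ▸ hxy.symm
  have hadj : ∀ x y, (universalGlue κ P G₀).graph.Adj (Φ x) (Φ y) ↔ G.Adj x y := by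
    intro x y
    by_cases hx : x ∈ S <;> by_cases hy : y ∈ S
    · rw [hΦS x hx, hΦS y hy]
      exact (glueCore G₀ _ _ _).map_adj_iff.trans e.map_adj_iff
    · rw [adj_comm, hmix y x hy hx, adj_comm]
    · exact hmix x y hx hy
    · by_cases hC : (G.induce A).connectedComponentMk ⟨x, (hA x).2 hx⟩ =
          (G.induce A).connectedComponentMk ⟨y, (hA y).2 hy⟩
      · rw [hΦC _ x hx hC, hΦC _ y hy rfl]
        exact (gluePiece G₀ _ _ _ _).map_adj_iff.trans (φ _).map_adj_iff
      · refine iff_of_false (fun h => hC ?_) fun h => hC ?_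
        · rw [hΦC _ x hx rfl, hΦC _ y hy rfl] at h
          exact hj (fst_eq_of_glue_adj h)
        · exact ConnectedComponent.sound (Adj.reachable (G := G.induce A) h)
  refine ⟨⟨⟨Φ, fun x y hxy => ?_⟩, fun {x y} => hadj x y⟩, ?_⟩
  · by_cases hx : x ∈ S <;> by_cases hy : y ∈ S
    · rw [hΦS x hx, hΦS y hy] at hxy
      exact congrArg Subtype.val (e.injective (Sum.inl_injective hxy))
    · rw [hΦS x hx, hΦC _ y hy rfl] at hxy
      cases hxy
    · rw [hΦS y hy, hΦC _ x hx rfl] at hxy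
      cases hxy
    · have hC : (G.induce A).connectedComponentMk ⟨x, (hA x).2 hx⟩ =
          (G.induce A).connectedComponentMk ⟨y, (hA y).2 hy⟩ := by
        rw [hΦC _ x hx rfl, hΦC _ y hy rfl] at hxy
        exact hj (congrArg Sigma.fst (Sum.inr_injective hxy))
      rw [hΦC _ x hx hC, hΦC _ y hy rfl] at hxy
      have := eq_of_heq (Sigma.mk.inj (Sum.inr_injective hxy)).2
      exact congrArg (fun z => z.1.1) ((φ _).injective this)
  · ext z
    constructor
    · rintro ⟨x, hx, rfl⟩
      exact ⟨_, (hΦS x hx).symm⟩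
    · rintro ⟨w, rfl⟩
      refine ⟨(e.symm w).1, (e.symm w).2, (hΦS _ (e.symm w).2).trans ?_⟩
      exact congrArg _ (e.apply_symm_apply w)

end Universal

/-! ### Universal families by induction on the rank. -/

section UniversalFamily

open SimpleGraph

theorem mem_raylessClass_of_hom {κ : Cardinal.{u}} {V W : Type u} {G : SimpleGraph V}
    {H : SimpleGraph W} (hH : (⟨W, H⟩ : Grph.{u}) ∈ raylessClass κ evenCycles) (hG : G.Connected)
    (f : G →g H) (hf : Function.Injective f) :
    (⟨V, G⟩ : Grph.{u}) ∈ raylessClass κ evenCycles := by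
  refine ⟨hG, (mk_le_of_injective hf).trans hH.2.1, ?_, ?_⟩
  · rintro ⟨r, hr, hadj⟩
    exact hH.2.2.1 ⟨f ∘ r, hf.comp hr, fun n => f.map_adj (hadj n)⟩
  · exact isFreeOf_evenCycles_iff.2 ((isFreeOf_evenCycles_iff.1 hH.2.2.2).comap f hf)

/-- A family of members of the class, all with the property `R`, such that every member of the
class with this property convexly embeds into some graph of the family. -/
structure IsConvexlyUniversal (κ : Cardinal.{u}) (R : Grph.{u} → Prop) {ι : Type u}
    (P : ι → Grph.{u}) : Prop where
  mem : ∀ i, P i ∈ raylessClass κ evenCycles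
  prop : ∀ i, R (P i)
  embeds : ∀ G ∈ raylessClass κ evenCycles, R G → ∀ S₀ : Set G.V, S₀.Finite →
    ∃ i, ConvexlyEmbeds G.graph S₀ (P i).graph

theorem mk_shrink_Iio (α : Ordinal.{u}) : #(Shrink.{u} (Set.Iio α)) = α.card := by
  rw [← Cardinal.lift_inj.{u, u + 1}, ← mk_Iio_ordinal, Cardinal.lift_mk_shrink'']

/-- The union of the families for all `β < α`. The bound `μ` is `κ` in the induction and `κ⁺` for
the whole class. -/
theorem exists_isConvexlyUniversal_lt {κ μ : Cardinal.{u}} (hμ : ℵ₀ ≤ μ) {α : Ordinal.{u}}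
    (hα : α.card ≤ μ)
    (h : ∀ β < α, ∃ (ι : Type u) (P : ι → Grph.{u}), #ι ≤ μ ∧
      IsConvexlyUniversal κ (fun G => RankLE β G.graph) P) :
    ∃ (ι : Type u) (P : ι → Grph.{u}), #ι ≤ μ ∧
      IsConvexlyUniversal κ (fun G => ∃ β < α, RankLE β G.graph) P := by
  choose ι P hι hP using h
  let s := (equivShrink.{u} (Set.Iio α)).symm
  refine ⟨Σ x : Shrink.{u} (Set.Iio α), ι (s x).1 (s x).2, fun i => P _ _ i.2,
    mk_sigma_le_of_le hμ ((mk_shrink_Iio α).trans_le hα) fun _ => hι _ _,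
    fun i => (hP _ _).mem _, fun i => ⟨_, (s i.1).2, (hP _ _).prop _⟩, ?_⟩
  rintro G hG ⟨β, hβ, hr⟩ S₀ hS₀
  have hx : s (equivShrink.{u} (Set.Iio α) ⟨β, hβ⟩) = ⟨β, hβ⟩ := Equiv.symm_apply_apply _ _
  generalize equivShrink.{u} (Set.Iio α) ⟨β, hβ⟩ = x at hx
  have hr' : RankLE (s x).1 G.graph := by rw [hx]; exact hr
  obtain ⟨i, hi⟩ := (hP (s x).1 (s x).2).embeds G hG hr' S₀ hS₀
  exact ⟨⟨x, i⟩, hi⟩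

theorem exists_isConvexlyUniversal_step {κ : Cardinal.{u}} (hκ : ℵ₀ ≤ κ) {α : Ordinal.{u}}
    {ι : Type u} {P : ι → Grph.{u}} (hι : #ι ≤ κ)
    (hP : IsConvexlyUniversal κ (fun G => ∃ β < α, RankLE β G.graph) P) :
    ∃ (ι : Type u) (P : ι → Grph.{u}), #ι ≤ κ ∧
      IsConvexlyUniversal κ (fun G => RankLE α G.graph) P := by
  refine ⟨ULift (Σ n : ℕ, {G₀ : SimpleGraph (Fin n) // G₀.Connected ∧ OddCycles G₀}),
    fun i => universalGlue κ P i.down.2.1, (mk_le_aleph0).trans hκ,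
    fun i => universalGlue_mem_raylessClass hκ hι hP.mem i.down.2.2.1 i.down.2.2.2,
    fun i => rankLE_glue fun j => hP.prop _, ?_⟩
  intro G hG hr S₀ hS₀
  have hodd := isFreeOf_evenCycles_iff.1 hG.2.2.2
  obtain ⟨F, hF, hC⟩ := rankLE_iff.1 hr
  -- Containing `F` makes the remaining components small in rank; containing `S₀` lets `S`, which is
  -- mapped onto the core, witness convexity.
  obtain ⟨S, hSf, hne, hsub, hS⟩ := hodd.exists_pathConvex hG.1 (hF.union hS₀)
  have := hSf.to_subtype
  obtain ⟨n, ⟨e⟩⟩ := Finite.exists_equiv_fin S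
  let e' : G.graph.induce S ≃g (G.graph.induce S).map e.toEmbedding := Iso.map e _
  have hconn := hS.induce_connected hG.1 hne
  have hodd' : OddCycles (G.graph.induce S) :=
    hodd.comap (Embedding.induce S).toHom Subtype.val_injective
  obtain ⟨Φ, hΦ⟩ := exists_embedding_universalGlue (κ := κ) (P := P) hG.1 hodd hG.2.1 (A := Sᶜ)
    (fun _ => Iff.rfl) hne hS e' fun C N hN => by
      have hle : Sᶜ ≤ Fᶜ := fun x hx hxF => hx (hsub (Or.inl hxF))
      let f : G.graph.induce Sᶜ →g G.graph.induce Fᶜ := (induceHomOfLE G.graph hle).toHom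
      obtain ⟨k, hk⟩ := exists_component_hom f (Set.inclusion_injective hle) C
      obtain ⟨γ, hγ, hr⟩ := hC (C.map f)
      exact hP.embeds ⟨_, C.toSimpleGraph⟩ (mem_raylessClass_of_hom hG C.connected_toSimpleGraph
        ((Embedding.induce Sᶜ).toHom.comp C.toSimpleGraph_hom)
        fun _ _ h => Subtype.ext (Subtype.ext h)) ⟨γ, hγ, hr.comap k hk⟩ N hN
  refine ⟨⟨⟨n, _, e'.connected_iff.1 hconn, hodd'.comap e'.symm.toHom e'.symm.injective⟩⟩,
    Φ, S, Set.subset_union_right.trans hsub, ?_⟩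
  rw [hΦ]
  exact pathConvex_range_glueCore

theorem card_le_of_lt_ord_succ {κ : Cardinal.{u}} {α : Ordinal.{u}}
    (hα : α < (Order.succ κ).ord) : α.card ≤ κ :=
  Order.lt_succ_iff.1 (lt_ord.1 hα)

theorem exists_isConvexlyUniversal {κ : Cardinal.{u}} (hκ : ℵ₀ ≤ κ) (α : Ordinal.{u})
    (hα : α < (Order.succ κ).ord) :
    ∃ (ι : Type u) (P : ι → Grph.{u}), #ι ≤ κ ∧
      IsConvexlyUniversal κ (fun G => RankLE α G.graph) P := by
  induction α using WellFoundedLT.induction with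
  | ind α ih =>
    obtain ⟨ι, P, hι, hP⟩ := exists_isConvexlyUniversal_lt hκ (card_le_of_lt_ord_succ hα)
      fun β hβ => ih β hβ (hβ.trans hα)
    exact exists_isConvexlyUniversal_step hκ hι hP

/-- An open ear of the image has its ends in the path-convex set `Φ '' T`, so it stays there and
pulls back to an open ear of `K`. -/
theorem not_hasOpenEar_map {V W : Type u} {G : SimpleGraph V} {H : SimpleGraph W}
    {K : G.Subgraph} (hK : ¬ HasOpenEar K) (Φ : G ↪g H) {T : Set V} (hKT : K.verts ⊆ T)
    (hT : PathConvex H (Φ '' T)) : ¬ HasOpenEar (K.map Φ.toHom) := by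
  rintro ⟨a, b, p, hp, hl, hs, he⟩
  have hverts : (K.map Φ.toHom).verts = Φ '' K.verts := rfl
  obtain ⟨a, ha, rfl⟩ : a ∈ Φ '' K.verts :=
    hverts ▸ (hs a p.start_mem_support).2 (Or.inl rfl)
  obtain ⟨b, hb, rfl⟩ : b ∈ Φ '' K.verts :=
    hverts ▸ (hs b p.end_mem_support).2 (Or.inr rfl)
  obtain ⟨q, rfl⟩ := exists_walk_map_eq Φ p fun z hz =>
    Set.image_subset_range _ _ (hT p hp ⟨a, hKT ha, rfl⟩ ⟨b, hKT hb, rfl⟩ z hz)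
  refine hK ⟨a, b, q, (Walk.isPath_map_iff_of_injective Φ.injective).1 hp, by simpa using hl,
    fun w hw => ?_, fun e hq hKe => ?_⟩
  · have := hs (Φ w) (by
      rw [Walk.support_map]
      exact List.mem_map_of_mem hw)
    rw [hverts, Φ.injective.mem_set_image, Φ.injective.eq_iff, Φ.injective.eq_iff] at this
    exact this
  · refine he (e.map Φ) (by
      rw [Walk.edges_map]
      exact List.mem_map_of_mem hq) ?_
    induction e with
    | h x y => exact ⟨x, y, hKe, rfl, rfl⟩

end UniversalFamily

/-! ### Rayless graphs have rank below `κ⁺`. -/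

section RankExistence

open SimpleGraph

/-- At most `κ` components occur, so by regularity of `κ⁺` the supremum of their bounds stays below
`κ⁺`. -/
theorem rankLE_of_components {κ : Cardinal.{u}} (hκ : ℵ₀ ≤ κ) {V : Type u} {G : SimpleGraph V}
    (hV : #V ≤ κ) {F : Set V} (hF : F.Finite)
    (h : ∀ C : (G.induce Fᶜ).ConnectedComponent,
      ∃ β < (Order.succ κ).ord, RankLE β C.toSimpleGraph) :
    ∃ β < (Order.succ κ).ord, RankLE β G := by
  choose f hf hr using h
  have hcomp : #(G.induce Fᶜ).ConnectedComponent < Order.succ κ :=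
    Order.lt_succ_iff.2 (((mk_le_of_surjective (f := (G.induce Fᶜ).connectedComponentMk)
      fun C => C.exists_rep).trans (mk_set_le _)).trans hV)
  have hsup : iSup f < (Order.succ κ).ord :=
    Ordinal.iSup_lt_of_lt_cof ((isRegular_succ hκ).cof_ord.symm ▸ hcomp) hf
  refine ⟨Order.succ (iSup f),
    (isSuccLimit_ord (hκ.trans (Order.le_succ κ))).succ_lt hsup, rankLE_iff.2 ⟨F, hF, fun C => ?_⟩⟩
  exact ⟨f C, Order.lt_succ_iff.2 (Ordinal.le_iSup f C), hr C⟩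

/-- A graph induced on an induced subgraph is an induced graph. -/
theorem nonempty_induce_induce_iso {V : Type u} (G : SimpleGraph V) (A : Set V) (D : Set A) :
    Nonempty ((G.induce A).induce D ≃g G.induce (Subtype.val '' D)) :=
  ⟨⟨Equiv.ofBijective (fun x => ⟨x.1.1, x.1, x.2, rfl⟩)
    ⟨fun x y h => Subtype.ext (Subtype.ext (Subtype.mk.inj h)), by
      rintro ⟨_, x, hx, rfl⟩
      exact ⟨⟨x, hx⟩, rfl⟩⟩, Iff.rfl⟩⟩

/-- After deleting `v` some component has no rank below `κ⁺`, and by connectedness it contains a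
neighbour of `v`. Iterating builds a ray. -/
theorem exists_unranked_step {κ : Cardinal.{u}} (hκ : ℵ₀ ≤ κ) {V : Type u} {G : SimpleGraph V}
    (hV : #V ≤ κ) {A : Set V} {v : V} (hv : v ∈ A) (hA : (G.induce A).Connected)
    (hr : ¬ ∃ β < (Order.succ κ).ord, RankLE β (G.induce A)) :
    ∃ (A' : Set V) (v' : V), A' ⊆ A ∧ v ∉ A' ∧ v' ∈ A' ∧ G.Adj v v' ∧ (G.induce A').Connected ∧
      ¬ ∃ β < (Order.succ κ).ord, RankLE β (G.induce A') := by
  by_contra! hcon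
  refine hr (rankLE_of_components hκ ((mk_set_le A).trans hV) (Set.finite_singleton ⟨v, hv⟩)
    fun C => ?_)
  obtain ⟨e₁⟩ := nonempty_induce_induce_iso (G.induce A) {⟨v, hv⟩}ᶜ C.supp
  obtain ⟨e₂⟩ := nonempty_induce_induce_iso G A (Subtype.val '' C.supp)
  let e : C.toSimpleGraph ≃g G.induce (Subtype.val '' (Subtype.val '' C.supp)) := e₁.trans e₂
  obtain ⟨c, hc⟩ := C.exists_rep
  obtain ⟨p⟩ := hA.preconnected c ⟨v, hv⟩
  obtain ⟨d, -, ⟨x, hx, hxd⟩, hd⟩ := p.exists_boundary_dart (Subtype.val '' C.supp) ⟨c, hc, rfl⟩ (by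
    rintro ⟨x, -, hx⟩
    exact x.2 hx)
  have hdv : d.snd = ⟨v, hv⟩ := by
    by_contra hne
    refine hd ⟨⟨d.snd, hne⟩, ?_, rfl⟩
    rw [← (ConnectedComponent.mem_supp_iff _ _).1 hx]
    refine ConnectedComponent.sound (Adj.reachable (G := (G.induce A).induce {⟨v, hv⟩}ᶜ) ?_)
    have := d.adj.symm
    rw [← hxd] at this
    exact this
  have hadj : G.Adj v x.1.1 := by
    have := d.adj.symm
    rw [← hxd, hdv] at this
    exact this
  obtain ⟨β, hβ, h⟩ := hcon (Subtype.val '' (Subtype.val '' C.supp)) x.1.1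
    (by rintro _ ⟨y, -, rfl⟩; exact y.2)
    (by
      rintro ⟨_, ⟨y, -, rfl⟩, hy⟩
      exact y.2 (Subtype.ext hy))
    ⟨_, ⟨x, hx, rfl⟩, rfl⟩ hadj (e.connected_iff.1 C.connected_toSimpleGraph)
  exact ⟨β, hβ, h.comap e.toHom e.injective⟩

/-- A connected rayless graph with at most `κ` vertices has some rank below `κ⁺`. -/
theorem exists_rankLE_lt {κ : Cardinal.{u}} (hκ : ℵ₀ ≤ κ) {V : Type u} {G : SimpleGraph V}
    (hG : G.Connected) (hV : #V ≤ κ) (hray : IsRayless G) :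
    ∃ β < (Order.succ κ).ord, RankLE β G := by
  by_contra hcon
  let X := {s : Set V × V // s.2 ∈ s.1 ∧ (G.induce s.1).Connected ∧
    ¬ ∃ β < (Order.succ κ).ord, RankLE β (G.induce s.1)}
  have hstep : ∀ s : X, ∃ t : X, t.1.1 ⊆ s.1.1 ∧ s.1.2 ∉ t.1.1 ∧ G.Adj s.1.2 t.1.2 := by
    rintro ⟨⟨A, v⟩, hv, hA, hr⟩
    obtain ⟨A', v', h1, h2, h3, h4, h5, h6⟩ := exists_unranked_step hκ hV hv hA hr
    exact ⟨⟨(A', v'), h3, h5, h6⟩, h1, h2, h4⟩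
  choose f hf using hstep
  obtain ⟨r⟩ := hG.nonempty
  let s₀ : X := ⟨(Set.univ, r), Set.mem_univ _, (induceUnivIso G).connected_iff.2 hG,
    fun ⟨β, hβ, h⟩ => hcon ⟨β, hβ, h.comap (induceUnivIso G).symm.toHom
      (induceUnivIso G).symm.injective⟩⟩
  let s : ℕ → X := fun n => f^[n] s₀
  have hs : ∀ n, s (n + 1) = f (s n) := fun n => Function.iterate_succ_apply' f n s₀
  have hanti : Antitone fun n => (s n).1.1 := antitone_nat_of_succ_le fun n => by
    rw [hs]
    exact (hf (s n)).1
  -- The sets decrease and each omits the previous vertex, so no vertex recurs.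
  have hne : ∀ n m, n < m → (s n).1.2 ≠ (s m).1.2 := fun n m hnm h => by
    have h1 := hanti (Nat.succ_le_of_lt hnm) (s m).2.1
    rw [← h] at h1
    simp only [Nat.succ_eq_add_one, hs] at h1
    exact (hf (s n)).2.1 h1
  refine hray ⟨fun n => (s n).1.2, fun n m h => ?_, fun n => ?_⟩
  · rcases lt_trichotomy n m with hnm | hnm | hnm
    · exact absurd h (hne n m hnm)
    · exact hnm
    · exact absurd h.symm (hne m n hnm)
  · have := (hf (s n)).2.2
    rwa [← hs] at this

end RankExistence

/-! ### Graphs of large rank. -/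

section LowerBound

open SimpleGraph

/-- The class contains graphs of arbitrarily large rank below `κ⁺`. -/
theorem exists_mem_raylessClass_not_rankLE {κ : Cardinal.{u}} (hκ : ℵ₀ ≤ κ) (α : Ordinal.{u})
    (hα : α < (Order.succ κ).ord) :
    ∃ G ∈ raylessClass κ evenCycles, ∀ γ < α, ¬ RankLE γ G.graph := by
  induction α using WellFoundedLT.induction with
  | ind α ih =>
    choose Q hQ hQr using fun x : Set.Iio α => ih x x.2 (x.2.trans hα)
    let s := (equivShrink.{u} (Set.Iio α)).symm
    -- Infinitely many copies of every `Q β` with `β < α` hang on one vertex, each by a single edge,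
    -- so the parity condition is vacuous.
    let P : ULift.{u} ℕ × Shrink.{u} (Set.Iio α) → Grph.{u} := fun j => Q (s j.2)
    have hne : ∀ j, Nonempty (P j).V := fun j => (hQ _).1.nonempty
    let N : ∀ j, Set (P j).V := fun j => {(hne j).some}
    have hJ : #(ULift.{u} ℕ × Shrink.{u} (Set.Iio α)) ≤ κ := by
      rw [mk_prod, lift_id, lift_id]
      refine mul_le_of_le hκ (mk_le_aleph0.trans hκ) ?_
      rw [mk_shrink_Iio]
      exact card_le_of_lt_ord_succ hα
    refine ⟨⟨_, glue (⊥ : SimpleGraph Unit) P (fun _ => ()) N⟩,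
      glue_mem_raylessClass hκ hJ Connected.of_subsingleton ?_ (fun _ => hQ _)
        (fun _ => Set.singleton_nonempty _) ?_, ?_⟩
    · intro a c hc
      exact absurd rfl hc.isCircuit.ne_bot
    · rintro j x y rfl rfl hne
      exact absurd rfl hne
    · intro γ hγ hr
      obtain ⟨F, hF, hC⟩ := rankLE_iff.1 hr
      let x := equivShrink.{u} (Set.Iio α) ⟨γ, hγ⟩
      have hx : s x = ⟨γ, hγ⟩ := Equiv.symm_apply_apply _ _
      -- The finite `F` misses some copy of `Q γ`, which then lies in a single component of supposed
      -- rank below `γ`.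
      obtain ⟨n, hn⟩ : ∃ n : ℕ, ∀ y, gluePiece (⊥ : SimpleGraph Unit) P (fun _ => ()) N
          (⟨n⟩, x) y ∉ F := by
        by_contra! hcon
        choose y hy using hcon
        refine Set.infinite_of_injective_forall_mem (fun n m h => ?_) hy hF
        exact congrArg (fun z : Σ j, (P j).V => z.1.1.down) (Sum.inr_injective h)
      let k : (P (⟨n⟩, x)).graph →g
          (glue (⊥ : SimpleGraph Unit) P (fun _ => ()) N).induce Fᶜ :=
        ⟨fun y => ⟨_, hn y⟩, fun h => (gluePiece _ P _ N (⟨n⟩, x)).map_adj_iff.2 h⟩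
      have hk : Function.Injective k := fun y z h =>
        (gluePiece (⊥ : SimpleGraph Unit) P (fun _ => ()) N (⟨n⟩, x)).injective
          (congrArg Subtype.val h)
      have hconn : (P (⟨n⟩, x)).graph.Connected := (hQ _).1
      obtain ⟨y₀⟩ := hconn.nonempty
      obtain ⟨δ, hδ, h⟩ := hC (connectedComponentMk _ (k y₀))
      refine hQr (s x) δ (by rw [hx]; exact hδ) (h.comap ⟨fun y => ⟨k y, ?_⟩, fun {y z} h => ?_⟩ ?_)
      · exact ConnectedComponent.sound ((hconn.preconnected y y₀).map k)
      · exact k.map_adj h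
      · intro y z h
        exact hk (congrArg Subtype.val h)

end LowerBound

end RaylessGraphs

/-! ### The main theorem. -/

open RaylessGraphs in
theorem mainTheorem6 (κ : Cardinal.{u}) (hκ : ℵ₀ ≤ κ) :
    (∀ α : Ordinal.{u}, α ≠ 0 → α < (Order.succ κ).ord →
      ∃ F : Set RaylessGraphs.Grph.{u},
        F ⊆ RaylessGraphs.raylessClassBelow κ α RaylessGraphs.evenCycles ∧
        (∀ G ∈ RaylessGraphs.raylessClassBelow κ α RaylessGraphs.evenCycles,
          ∀ K : G.graph.Subgraph, K.verts.Finite →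
            ∃ H ∈ F, ∃ Φ : G.graph ↪g H.graph,
              ¬ RaylessGraphs.HasOpenEar K →
                ¬ RaylessGraphs.HasOpenEar (K.map Φ.toHom)) ∧
        #F ≤ Cardinal.lift.{u + 1} κ) ∧
    (∃ F : Set RaylessGraphs.Grph.{u},
      RaylessGraphs.IsStronglyUniversal F
        (RaylessGraphs.raylessClass κ RaylessGraphs.evenCycles)) ∧
    RaylessGraphs.strongComplexity (RaylessGraphs.raylessClass κ RaylessGraphs.evenCycles) =
      Cardinal.lift.{u + 1} (Order.succ κ) := by
  have hrange : ∀ {ι : Type u} {μ : Cardinal.{u}} (P : ι → Grph.{u}), #ι ≤ μ →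
      #(Set.range P) ≤ Cardinal.lift.{u + 1} μ := fun P hι => by
    rw [← Cardinal.lift_id'.{u, u + 1} #(Set.range P)]
    exact mk_range_le_lift.trans (Cardinal.lift_le.{u + 1}.2 hι)
  obtain ⟨ι, P, hι, hP⟩ := exists_isConvexlyUniversal_lt (κ := κ) (hκ.trans (Order.le_succ κ))
    (card_ord (Order.succ κ)).le fun β hβ => by
      obtain ⟨ι, P, hι, hP⟩ := exists_isConvexlyUniversal hκ β hβ
      exact ⟨ι, P, hι.trans (Order.le_succ κ), hP⟩
  have huniv : IsStronglyUniversal (Set.range P) (raylessClass κ evenCycles) := by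
    refine ⟨Set.range_subset_iff.2 hP.mem, fun G hG => ?_⟩
    obtain ⟨i, Φ, -⟩ := hP.embeds G hG (exists_rankLE_lt hκ hG.1 hG.2.1 hG.2.2.1) ∅ Set.finite_empty
    exact ⟨_, ⟨i, rfl⟩, ⟨Φ⟩⟩
  refine ⟨fun α _ hα => ?_, ⟨_, huniv⟩, le_antisymm ?_ ?_⟩
  · obtain ⟨ι, P, hι, hP⟩ := exists_isConvexlyUniversal_lt hκ (card_le_of_lt_ord_succ hα)
      fun β hβ => exists_isConvexlyUniversal hκ β (hβ.trans hα)
    refine ⟨Set.range P, ?_, ?_, hrange P hι⟩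
    · rintro _ ⟨i, rfl⟩
      obtain ⟨β, hβ, γ, hγ, h⟩ := hP.prop i
      exact ⟨hP.mem i, γ, hγ.trans_lt hβ, h⟩
    · rintro G ⟨hG, β, hβ, h⟩ K hK
      obtain ⟨i, Φ, T, hKT, hT⟩ := hP.embeds G hG ⟨β, hβ, β, le_rfl, h⟩ K.verts hK
      exact ⟨_, ⟨i, rfl⟩, Φ, fun hear => not_hasOpenEar_map hear Φ hKT hT⟩
  · have hmem : #(Set.range P) ∈
        {c | ∃ F, IsStronglyUniversal F (raylessClass κ evenCycles) ∧ #F = c} := ⟨_, huniv, rfl⟩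
    exact (csInf_le' hmem).trans (hrange P hι)
  · refine le_csInf ⟨_, _, huniv, rfl⟩ ?_
    rintro c ⟨F, ⟨hF, hF'⟩, rfl⟩
    -- Fewer than `κ⁺` graphs have ranks bounded by some ordinal below `κ⁺`, and a graph exceeding
    -- that bound embeds in none of them.
    by_contra! hlt
    choose f hf hr using fun H : F =>
      exists_rankLE_lt hκ (hF H.2).1 (hF H.2).2.1 (hF H.2).2.2.1
    -- `F` lives one universe up; it is reindexed by a type in `u` to form the supremum of ordinals
    -- there.
    obtain ⟨a, ha⟩ := Cardinal.mem_range_lift_of_le hlt.le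
    obtain ⟨e⟩ : Nonempty (a.out ≃ F) :=
      lift_mk_eq'.1 (by rw [mk_out, ha, Cardinal.lift_id'.{u, u + 1}])
    have hsup : iSup (f ∘ e) < (Order.succ κ).ord := by
      refine Ordinal.iSup_lt_of_lt_cof ?_ fun _ => hf _
      rwa [(isRegular_succ hκ).cof_ord, mk_out, ← Cardinal.lift_lt.{u, u + 1}, ha]
    obtain ⟨G, hG, hGr⟩ := exists_mem_raylessClass_not_rankLE hκ _
      ((isSuccLimit_ord (hκ.trans (Order.le_succ κ))).succ_lt hsup)
    obtain ⟨H, hH, ⟨Φ⟩⟩ := hF' G hG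
    refine hGr _ (Order.lt_succ _) (((hr ⟨H, hH⟩).comap Φ.toHom Φ.injective).mono ?_)
    have := Ordinal.le_iSup (f ∘ e) (e.symm ⟨H, hH⟩)
    rwa [Function.comp_apply, e.apply_symm_apply] at this
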